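/- Let $c$ be the complex Banach space of convergent complex sequences with the supremum norm, let $B=B_c$ be its open unit ball, and let $\overline{B}^{**}$ be the closed unit ball of its bidual $c^{**}$. Let $A_u(B)$ be the algebra of all bounded analytic functions $f:B\to\mathbb{C}$ that are uniformly continuous on $B$, with the supremum norm; it contains the restrictions to $B$ of the functionals in $c^*$. Let $M$ be the spectrum of $A_u(B)$ (the set of nonzero continuous multiplicative linear functionals $\tau:A_u(B)\to\mathbb{C}$), and write $\hat f(\tau)=\tau(f)$ for the Gelfand transform. For $x^{**}\in\overline{B}^{**}$ let $$M_{x^{**}}=\{\tau\in M:\ \tau(x^*|_B)=x^{**}(x^*)\ \text{for all } x^*\in c^*\}$$ be the fiber over $x^{**}$, and for $f\in A_u(B)$ let $Cl_B(f,x^{**})$ be the set of all limits of $f(x_\alpha)$ along nets $(x_\alpha)$ in $B$ that converge weak-star to $x^{**}$. Then $c$ satisfies the cluster value theorem for $A_u(B)$ at every point of $\overline{B}^{**}$, that is, for every $x^{**}\in\overline{B}^{**}$, $$Cl_B(f,x^{**})=\hat f(M_{x^{**}})\qquad\text{for all } f\in A_u(B).$$ Moreover, for every $x^{**}\in\overline{B}^{**}$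 the fiber $M_{x^{**}}$ consists of exactly one point. -/

import Mathlib

open Filter Topology
open scoped ENNReal BoundedContinuousFunction

noncomputable section

namespace ClusterValue

/-- The space `c` of convergent complex sequences, as a subspace of `ℓ^∞` (with the sup norm). -/
def convSeqSubmodule : Submodule ℂ (lp (fun _ : ℕ => ℂ) ∞) where
  carrier := {x | ∃ a : ℂ, Tendsto (fun n => x n) atTop (𝓝 a)}
  zero_mem' := ⟨0, by simp⟩
  add_mem' := by
    rintro x y ⟨a, ha⟩ ⟨b, hb⟩
    exact ⟨a + b, by simpa using ha.add hb⟩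
  smul_mem' := by
    rintro k x ⟨a, ha⟩
    exact ⟨k • a, by simpa using ha.const_mul k⟩

/-- The space `c` as a normed space in its own right. -/
def ConvSeq : Type := convSeqSubmodule

instance : NormedAddCommGroup ConvSeq := inferInstanceAs (NormedAddCommGroup convSeqSubmodule)

instance : NormedSpace ℂ ConvSeq := inferInstanceAs (NormedSpace ℂ convSeqSubmodule)

section General

variable (X : Type*) [NormedAddCommGroup X] [NormedSpace ℂ X]

/-- The open unit ball `B` of `X`. -/
abbrev UnitBall : Type _ := Metric.ball (0 : X) 1

/-- The algebra `A_u(B)` of bounded analytic functions on the open unit ball `B` of `X` that are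
uniformly continuous on `B`, with pointwise operations and the sup norm inherited from `B →ᵇ ℂ`. -/
def Au : Subalgebra ℂ (UnitBall X →ᵇ ℂ) where
  carrier := {f | UniformContinuous f ∧
    ∃ F : X → ℂ, AnalyticOnNhd ℂ F (Metric.ball 0 1) ∧ ∀ x : UnitBall X, f x = F x}
  add_mem' := by
    rintro f g ⟨hf, F, hF, hfF⟩ ⟨hg, G, hG, hgG⟩
    exact ⟨hf.add hg, F + G, hF.add hG, fun x => by simp [hfF, hgG]⟩
  mul_mem' := by
    rintro f g ⟨hf, F, hF, hfF⟩ ⟨hg, G, hG, hgG⟩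
    refine ⟨?_, F * G, hF.mul hG, fun x => by simp [hfF, hgG]⟩
    rw [Metric.uniformContinuous_iff] at hf hg ⊢
    intro ε hε
    have hM : 0 < ‖f‖ + ‖g‖ + 1 := by positivity
    obtain ⟨δ, hδ, h⟩ := hf (ε / (‖f‖ + ‖g‖ + 1)) (div_pos hε hM)
    obtain ⟨η, hη, k⟩ := hg (ε / (‖f‖ + ‖g‖ + 1)) (div_pos hε hM)
    refine ⟨min δ η, lt_min hδ hη, fun a b hab => ?_⟩
    have h1 := h (lt_of_lt_of_le hab (min_le_left _ _))
    have h2 := k (lt_of_lt_of_le hab (min_le_right _ _))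
    rw [dist_eq_norm, lt_div_iff₀ hM] at h1 h2
    rw [dist_eq_norm]
    have e : (f * g) a - (f * g) b = f a * (g a - g b) + (f a - f b) * g b := by
      simp only [BoundedContinuousFunction.coe_mul, Pi.mul_apply]; ring
    rw [e]
    refine (norm_add_le _ _).trans_lt ?_
    rw [norm_mul, norm_mul]
    have hfa := f.norm_coe_le_norm a
    have hgb := g.norm_coe_le_norm b
    have p1 := mul_le_mul_of_nonneg_right hfa (norm_nonneg (g a - g b))
    have p2 := mul_le_mul_of_nonneg_left hgb (norm_nonneg (f a - f b))
    by_contra! hc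
    have q1 : ‖f‖ * (‖g a - g b‖ * (‖f‖ + ‖g‖ + 1)) ≤ ‖f‖ * ε :=
      mul_le_mul_of_nonneg_left h2.le (norm_nonneg _)
    have q2 : ‖g‖ * (‖f a - f b‖ * (‖f‖ + ‖g‖ + 1)) ≤ ‖g‖ * ε :=
      mul_le_mul_of_nonneg_left h1.le (norm_nonneg _)
    have q3 : ε * (‖f‖ + ‖g‖ + 1) ≤
        (‖f‖ * ‖g a - g b‖ + ‖f a - f b‖ * ‖g‖) * (‖f‖ + ‖g‖ + 1) :=
      mul_le_mul_of_nonneg_right (by linarith) hM.le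
    nlinarith
  algebraMap_mem' := fun r =>
    ⟨uniformContinuous_const, fun _ => r, analyticOnNhd_const, fun _ => rfl⟩

variable {X}

/-- The restriction of a functional `φ ∈ X*` to `B`, as a bounded continuous function. -/
def dualRestrict (φ : StrongDual ℂ X) : UnitBall X →ᵇ ℂ :=
  BoundedContinuousFunction.ofNormedAddCommGroup (fun x : UnitBall X => φ x)
    (φ.continuous.comp continuous_subtype_val) ‖φ‖ (fun x =>
      (φ.le_opNorm x).trans (mul_le_of_le_one_right (norm_nonneg _)
        (mem_ball_zero_iff.mp x.2).le))

theorem dualRestrict_mem (φ : StrongDual ℂ X) : dualRestrict φ ∈ Au X :=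
  ⟨φ.uniformContinuous.comp uniformContinuous_subtype_val, φ,
    fun _ _ => φ.analyticAt _, fun _ => rfl⟩

variable (X) in
/-- The inclusion `X* ⊂ A_u(B)`, `φ ↦ φ|_B`, as a continuous linear map. -/
def dualToAu : StrongDual ℂ X →L[ℂ] Au X :=
  LinearMap.mkContinuous
    { toFun := fun φ => ⟨dualRestrict φ, dualRestrict_mem φ⟩
      map_add' := fun _ _ => rfl
      map_smul' := fun _ _ => rfl } 1
    (fun φ => by
      rw [one_mul]
      exact BoundedContinuousFunction.norm_ofNormedAddCommGroup_le _ (norm_nonneg _)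
        (fun x : UnitBall X => (φ.le_opNorm x).trans (mul_le_of_le_one_right (norm_nonneg _)
          (mem_ball_zero_iff.mp x.2).le)))

/-- The projection `π(τ) = τ|_{X*}` from the spectrum of `A_u(B)` to the bidual `X**`. -/
def spectrumProj (τ : WeakDual.characterSpace ℂ (Au X)) : StrongDual ℂ (StrongDual ℂ X) :=
  (WeakDual.CharacterSpace.toCLM τ).comp (dualToAu X)

/-- The fiber `M_z(B) = π⁻¹(z)` of the spectrum of `A_u(B)` over `z ∈ X**`. -/
def fiber (z : StrongDual ℂ (StrongDual ℂ X)) : Set (WeakDual.characterSpace ℂ (Au X)) :=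
  {τ | spectrumProj τ = z}

/-- The cluster set `Cl_B(f, z)`: all limits of values of `f` along nets (here: proper filters)
in `B` that converge weak-star to `z ∈ X**`. -/
def clusterSet (f : Au X) (z : StrongDual ℂ (StrongDual ℂ X)) : Set ℂ :=
  {a | ∃ l : Filter (UnitBall X), l.NeBot ∧
    Tendsto (fun x : UnitBall X =>
      StrongDual.toWeakDual (NormedSpace.inclusionInDoubleDual ℂ X x)) l
      (𝓝 (StrongDual.toWeakDual z)) ∧
    Tendsto (fun x : UnitBall X => (f : UnitBall X →ᵇ ℂ) x) l (𝓝 a)}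

/-- `X` satisfies the cluster value theorem for `A_u(B)` at `z`: the cluster set of every
`f ∈ A_u(B)` at `z` is the image of the fiber over `z` under the Gelfand transform of `f`. -/
def ClusterValueTheoremAt (z : StrongDual ℂ (StrongDual ℂ X)) : Prop :=
  ∀ f : Au X, clusterSet f z = WeakDual.gelfandTransform ℂ (Au X) f '' fiber z

end General

end ClusterValue

end

/-!
Call a weakly unconditionally Cauchy series WUC. If every WUC series in `Y` has terms tending to
zero (that is, if `Y` does not contain `c₀`), a gliding hump shows that an operator `T : c → Y` is
the norm limit of its finite rank truncations, and that the operators from `c` to `Y` have the same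
property: if `∑ S n` and `∑ x n` are WUC, so is the diagonal series `∑ S n (x n)`, by averaging over
signs. Writing an `(m + 1)`-linear form as an operator into the `m`-linear ones, we get by induction
that every homogeneous polynomial on `c` is a uniform limit on the ball of polynomials in
functionals. By uniform continuity and Taylor expansion so is every element of `A_u(B)`, hence a
character is determined by its restriction to `c*` and fibers have at most one point. Conversely,
every point of the bidual ball is a weak-star limit of points of `B` by Goldstine's theorem, and a
limit along an ultrafilter of the evaluations at these points is a character in the fiber; its
values are the corresponding cluster values.
-/

noncomputable section

namespace ClusterValue

section WUC

variable {𝕜 : Type*} [RCLike 𝕜] {E F ι κ : Type*} [NormedAddCommGroup E] [NormedSpace 𝕜 E]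
  [NormedAddCommGroup F] [NormedSpace 𝕜 F]

variable (𝕜) in
/-- The series `∑ y i` is weakly unconditionally Cauchy, i.e. `∑ |f (y i)| < ∞` for every
functional `f`. This is encoded by the equivalent uniform bound on its finite partial sums with
coefficients in the unit disc. -/
def IsWUC (y : ι → E) : Prop :=
  ∃ C : ℝ, ∀ t : ι → 𝕜, (∀ i, ‖t i‖ ≤ 1) → ∀ s : Finset ι, ‖∑ i ∈ s, t i • y i‖ ≤ C

theorem IsWUC.map {y : ι → E} (hy : IsWUC 𝕜 y) (T : E →L[𝕜] F) : IsWUC 𝕜 fun i => T (y i) := by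
  obtain ⟨C, hC⟩ := hy
  refine ⟨‖T‖ * C, fun t ht s => ?_⟩
  simpa only [map_sum, map_smul] using T.le_opNorm_of_le (hC t ht s)

theorem IsWUC.comp_injective {y : ι → E} (hy : IsWUC 𝕜 y) {φ : κ → ι}
    (hφ : Function.Injective φ) : IsWUC 𝕜 fun k => y (φ k) := by
  obtain ⟨C, hC⟩ := hy
  refine ⟨C, fun t ht s => ?_⟩
  have ht' : ∀ i, ‖Function.extend φ t 0 i‖ ≤ 1 := fun i => by
    classical
    rw [Function.extend_def]
    split_ifs
    · exact ht _
    · simp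
  simpa [hφ.extend_apply] using hC _ ht' (s.map ⟨φ, hφ⟩)

theorem IsWUC.exists_sum_norm_apply_le {y : ι → E} (hy : IsWUC 𝕜 y) :
    ∃ C : ℝ, ∀ f : StrongDual 𝕜 E, ‖f‖ ≤ 1 → ∀ s : Finset ι, ∑ i ∈ s, ‖f (y i)‖ ≤ C := by
  obtain ⟨C, hC⟩ := hy
  refine ⟨C, fun f hf s => ?_⟩
  choose t ht hty using fun i => RCLike.exists_norm_eq_mul_self (f (y i))
  have hsum : ((∑ i ∈ s, ‖f (y i)‖ : ℝ) : 𝕜) = f (∑ i ∈ s, t i • y i) := by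
    simp only [map_sum, map_smul, smul_eq_mul, hty]
  calc ∑ i ∈ s, ‖f (y i)‖ = ‖f (∑ i ∈ s, t i • y i)‖ := by
        rw [← hsum, RCLike.norm_of_nonneg (Finset.sum_nonneg fun _ _ => norm_nonneg _)]
    _ ≤ 1 * C := f.le_of_opNorm_le_of_le hf (hC t (fun i => (ht i).le) s)
    _ = C := one_mul C

variable (𝕜) in
theorem exists_sign_norm_le_norm_add_smul (x y : E) : ∃ σ : 𝕜, σ * σ = 1 ∧ ‖x‖ ≤ ‖x + σ • y‖ := by
  by_contra! hlt
  have hadd := hlt 1 (one_mul 1)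
  have hsub := hlt (-1) (by ring)
  have htwo : ‖(2 : 𝕜) • x‖ ≤ ‖x + (1 : 𝕜) • y‖ + ‖x + (-1 : 𝕜) • y‖ := by
    refine le_of_eq_of_le (congrArg _ ?_) (norm_add_le _ _)
    module
  rw [norm_smul, RCLike.norm_two] at htwo
  linarith

/-- For random independent signs the expectation of the right-hand vector is the left-hand one;
the induction picks the signs one at a time instead of averaging. -/
theorem exists_signs_norm_sum_apply_le (S : ι → E →L[𝕜] F) (x : ι → E) (s : Finset ι) (d : F) :
    ∃ ε : ι → 𝕜, (∀ i, ‖ε i‖ = 1) ∧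
      ‖d + ∑ i ∈ s, S i (x i)‖ ≤ ‖d + (∑ i ∈ s, ε i • S i) (∑ i ∈ s, ε i • x i)‖ := by
  classical
  induction s using Finset.induction_on generalizing d with
  | empty => exact ⟨fun _ => 1, by simp, by simp⟩
  | insert a s ha ih =>
    obtain ⟨ε, hε, hle⟩ := ih (d + S a (x a))
    set U := ∑ i ∈ s, ε i • S i
    set v := ∑ i ∈ s, ε i • x i
    obtain ⟨σ, hσ, hσle⟩ :=
      exists_sign_norm_le_norm_add_smul 𝕜 (d + S a (x a) + U v) (U (x a) + S a v)
    have hσ_norm : ‖σ‖ = 1 := by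
      have : ‖σ‖ * ‖σ‖ = 1 := by rw [← norm_mul, hσ, norm_one]
      nlinarith [norm_nonneg σ]
    have hupdate : ∀ i ∈ s, Function.update ε a σ i = ε i := fun i hi =>
      Function.update_of_ne (ne_of_mem_of_not_mem hi ha) _ _
    have hU : ∑ i ∈ insert a s, Function.update ε a σ i • S i = σ • S a + U := by
      rw [Finset.sum_insert ha, Function.update_self]
      exact congrArg _ (Finset.sum_congr rfl fun i hi => by rw [hupdate i hi])
    have hv : ∑ i ∈ insert a s, Function.update ε a σ i • x i = σ • x a + v := by
      rw [Finset.sum_insert ha, Function.update_self]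
      exact congrArg _ (Finset.sum_congr rfl fun i hi => by rw [hupdate i hi])
    refine ⟨Function.update ε a σ, fun i => ?_, ?_⟩
    · obtain rfl | hi := eq_or_ne i a <;> simp [*]
    · rw [hU, hv, Finset.sum_insert ha, ← add_assoc]
      refine (hle.trans hσle).trans_eq (congrArg _ ?_)
      simp only [_root_.add_apply, _root_.smul_apply, map_add, map_smul, smul_smul,
        smul_add, hσ, one_smul]
      abel

theorem IsWUC.clm_apply {S : ι → E →L[𝕜] F} {x : ι → E} (hS : IsWUC 𝕜 S) (hx : IsWUC 𝕜 x) :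
    IsWUC 𝕜 fun i => S i (x i) := by
  obtain ⟨C, hC⟩ := hS
  obtain ⟨D, hD⟩ := hx
  refine ⟨C * D, fun t ht s => ?_⟩
  obtain ⟨ε, hε, hle⟩ := exists_signs_norm_sum_apply_le S (fun i => t i • x i) s 0
  simp only [zero_add, map_smul, smul_smul] at hle
  exact hle.trans <| ContinuousLinearMap.le_of_opNorm_le_of_le _ (hC ε (fun i => (hε i).le) s)
    (hD _ (fun i => by rw [norm_mul, hε, one_mul]; exact ht i) s)

variable (𝕜 E) in
/-- The terms of every weakly unconditionally Cauchy series in `E` tend to zero. For Banach spaces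
this means, by a theorem of Bessaga and Pełczyński, that `E` has no subspace isomorphic to `c₀`. -/
def AvoidsCZero : Prop :=
  ∀ y : ℕ → E, IsWUC 𝕜 y → Tendsto y atTop (𝓝 0)

variable (𝕜) in
theorem avoidsCZero_self : AvoidsCZero 𝕜 𝕜 := by
  intro y hy
  obtain ⟨C, hC⟩ := hy.exists_sum_norm_apply_le
  have hsum : Summable fun n => ‖y n‖ :=
    summable_of_sum_le (fun _ => norm_nonneg _) (hC _ ContinuousLinearMap.norm_id_le)
  exact tendsto_zero_iff_norm_tendsto_zero.mpr hsum.tendsto_atTop_zero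

theorem AvoidsCZero.of_linearIsometry (hF : AvoidsCZero 𝕜 F) (e : E →ₗᵢ[𝕜] F) :
    AvoidsCZero 𝕜 E := fun y hy => by
  rw [tendsto_zero_iff_norm_tendsto_zero]
  simpa using (hF _ (hy.map e.toContinuousLinearMap)).norm

end WUC

section FiniteRank

variable {𝕜 : Type*} [NontriviallyNormedField 𝕜] {E F G : Type*} [NormedAddCommGroup E]
  [NormedSpace 𝕜 E] [NormedAddCommGroup F] [NormedSpace 𝕜 F] [NormedAddCommGroup G]
  [NormedSpace 𝕜 G]

variable (𝕜 E F) in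
/-- The space `E* ⊗ F` of continuous operators of finite rank, spanned by those of rank one. -/
def finiteRank : Submodule 𝕜 (E →L[𝕜] F) :=
  Submodule.span 𝕜 (Set.range fun p : StrongDual 𝕜 E × F => p.1.smulRight p.2)

theorem smulRight_mem_finiteRank (φ : StrongDual 𝕜 E) (v : F) :
    φ.smulRight v ∈ finiteRank 𝕜 E F :=
  Submodule.subset_span ⟨(φ, v), rfl⟩

theorem comp_mem_finiteRank (T : F →L[𝕜] G) {R : E →L[𝕜] F} (hR : R ∈ finiteRank 𝕜 E F) :
    T.comp R ∈ finiteRank 𝕜 E G := by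
  induction hR using Submodule.span_induction with
  | mem R hR =>
    obtain ⟨⟨φ, v⟩, rfl⟩ := hR
    have : T.comp (φ.smulRight v) = φ.smulRight (T v) := by ext; simp
    exact this ▸ smulRight_mem_finiteRank φ (T v)
  | zero => simp
  | add R R' _ _ hR hR' => simpa only [T.comp_add] using add_mem hR hR'
  | smul a R _ hR => simpa only [T.comp_smul] using Submodule.smul_mem _ a hR

theorem tendsto_comp_zero_of_mem_finiteRank {α : Type*} {l : Filter α} {S : α → F →L[𝕜] G}
    (hS : ∀ x, Tendsto (fun a => S a x) l (𝓝 0)) {R : E →L[𝕜] F} (hR : R ∈ finiteRank 𝕜 E F) :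
    Tendsto (fun a => (S a).comp R) l (𝓝 0) := by
  induction hR using Submodule.span_induction with
  | mem R hR =>
    obtain ⟨⟨φ, v⟩, rfl⟩ := hR
    have hcomp : ∀ a, (S a).comp (φ.smulRight v) = φ.smulRight (S a v) := fun a => by ext; simp
    have hcont := (ContinuousLinearMap.smulRightL 𝕜 E G φ).continuous.tendsto 0
    simpa [hcomp, Function.comp_def] using hcont.comp (hS v)
  | zero => simpa using tendsto_const_nhds
  | add R R' _ _ hR hR' => simpa only [ContinuousLinearMap.comp_add, add_zero] using hR.add hR'
  | smul c R _ hR => simpa only [ContinuousLinearMap.comp_smul, smul_zero] using hR.const_smul c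

end FiniteRank

namespace ConvSeq

/-- The convergent sequence with given terms. -/
def mk (x : ℕ → ℂ) (h : ∃ a, Tendsto x atTop (𝓝 a)) : ConvSeq :=
  (⟨⟨x, memℓp_infty h.choose_spec.norm.bddAbove_range⟩, h⟩ : convSeqSubmodule)

/-- The `n`-th term, as a functional on `c`. -/
def coord (n : ℕ) : StrongDual ℂ ConvSeq :=
  (lp.evalCLM ℂ (fun _ : ℕ => ℂ) ∞ n).comp convSeqSubmodule.subtypeL

@[simp]
theorem coord_mk (x : ℕ → ℂ) (h : ∃ a, Tendsto x atTop (𝓝 a)) (n : ℕ) : coord n (mk x h) = x n :=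
  rfl

theorem norm_coord_apply_le (n : ℕ) (x : ConvSeq) : ‖coord n x‖ ≤ ‖x‖ :=
  lp.norm_apply_le_norm ENNReal.top_ne_zero (x : convSeqSubmodule).1 n

theorem norm_coord_le (n : ℕ) : ‖coord n‖ ≤ 1 :=
  ContinuousLinearMap.opNorm_le_bound _ zero_le_one fun x => by
    rw [one_mul]
    exact norm_coord_apply_le n x

theorem norm_le_of_forall_coord {x : ConvSeq} {R : ℝ} (hR : 0 ≤ R) (h : ∀ n, ‖coord n x‖ ≤ R) :
    ‖x‖ ≤ R :=
  lp.norm_le_of_forall_le hR h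

theorem exists_tendsto_coord (x : ConvSeq) : ∃ a, Tendsto (fun n => coord n x) atTop (𝓝 a) :=
  (x : convSeqSubmodule).2

/-- The limit, as a functional on `c`. -/
def limit : StrongDual ℂ ConvSeq :=
  (linearMapOfTendsto (fun x => (exists_tendsto_coord x).choose)
    (fun n => (coord n : ConvSeq →ₗ[ℂ] ℂ))
    (tendsto_pi_nhds.mpr fun x => (exists_tendsto_coord x).choose_spec)).mkContinuous 1
    fun x => by
      rw [one_mul]
      exact le_of_tendsto (exists_tendsto_coord x).choose_spec.norm
        (Eventually.of_forall fun n => norm_coord_apply_le n x)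

theorem tendsto_coord (x : ConvSeq) : Tendsto (fun n => coord n x) atTop (𝓝 (limit x)) :=
  (exists_tendsto_coord x).choose_spec

theorem norm_limit_le : ‖limit‖ ≤ 1 :=
  LinearMap.mkContinuous_norm_le _ zero_le_one _

/-- The projection of `c` that replaces all terms from the `n`-th on by the limit. -/
def proj (n : ℕ) : ConvSeq →L[ℂ] ConvSeq :=
  limit.smulRight (mk 1 ⟨1, tendsto_const_nhds⟩) +
    ∑ i ∈ Finset.range n, (coord i - limit).smulRight
      (mk (Pi.single i 1) ⟨0, tendsto_const_nhds.congr' <|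
        (eventually_gt_atTop i).mono fun _ hj =>
          (Pi.single_eq_of_ne (M := fun _ => ℂ) hj.ne' 1).symm⟩)

theorem coord_proj (n j : ℕ) (x : ConvSeq) :
    coord j (proj n x) = if j < n then coord j x else limit x := by
  have hsum : coord j (proj n x) =
      limit x + ∑ i ∈ Finset.range n, (coord i x - limit x) * (Pi.single i 1 : ℕ → ℂ) j := by
    simp [proj]
  rw [hsum]
  split_ifs with hj <;> simp [Pi.single_apply, hj]

theorem proj_mem_finiteRank (n : ℕ) : proj n ∈ finiteRank ℂ ConvSeq ConvSeq :=
  add_mem (smulRight_mem_finiteRank _ _) (sum_mem fun _ _ => smulRight_mem_finiteRank _ _)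

theorem tendsto_proj (x : ConvSeq) : Tendsto (fun n => proj n x) atTop (𝓝 x) := by
  refine Metric.tendsto_atTop.mpr fun ε hε => ?_
  obtain ⟨N, hN⟩ := Metric.tendsto_atTop.mp (tendsto_coord x) (ε / 2) (half_pos hε)
  refine ⟨N, fun n hn => (half_lt_self hε).trans_le' ?_⟩
  rw [dist_eq_norm]
  refine norm_le_of_forall_coord (half_pos hε).le fun j => ?_
  rw [map_sub, coord_proj]
  split_ifs with hj
  · simpa using (half_pos hε).le
  · rw [← dist_eq_norm, dist_comm]
    exact (hN j (hn.trans (not_lt.mp hj))).le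

theorem isWUC_of_sum_norm_coord_le {ι : Type*} {y : ι → ConvSeq} {C : ℝ}
    (hC : ∀ n (s : Finset ι), ∑ i ∈ s, ‖coord n (y i)‖ ≤ C) : IsWUC ℂ y := by
  refine ⟨C, fun t ht s => norm_le_of_forall_coord (by simpa using hC 0 ∅) fun n => ?_⟩
  rw [map_sum]
  refine (norm_sum_le_of_le s fun i _ => ?_).trans (hC n s)
  rw [map_smul, norm_smul]
  exact mul_le_of_le_one_left (norm_nonneg _) (ht i)

theorem isWUC_sub_proj {ι : Type*} {y : ι → ConvSeq} (hy : IsWUC ℂ y) (n : ι → ℕ) :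
    IsWUC ℂ fun i => y i - proj (n i) (y i) := by
  obtain ⟨C, hC⟩ := hy.exists_sum_norm_apply_le
  refine isWUC_of_sum_norm_coord_le (C := C + C) fun k s => ?_
  have hle : ∀ i, ‖coord k (y i - proj (n i) (y i))‖ ≤ ‖coord k (y i)‖ + ‖limit (y i)‖ := by
    intro i
    rw [map_sub, coord_proj]
    split_ifs
    · rw [sub_self, norm_zero]
      positivity
    · exact norm_sub_le _ _
  calc ∑ i ∈ s, ‖coord k (y i - proj (n i) (y i))‖
      ≤ ∑ i ∈ s, ‖coord k (y i)‖ + ∑ i ∈ s, ‖limit (y i)‖ :=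
        (Finset.sum_le_sum fun i _ => hle i).trans_eq Finset.sum_add_distrib
    _ ≤ C + C := add_le_add (hC _ (norm_coord_le k) s) (hC _ norm_limit_le s)

theorem isWUC_proj_sub_proj {n : ℕ → ℕ} (hn : Monotone n) {x : ℕ → ConvSeq}
    (hx : ∀ j, ‖x j‖ ≤ 1) : IsWUC ℂ fun j => proj (n (j + 1)) (x j) - proj (n j) (x j) := by
  refine isWUC_of_sum_norm_coord_le (C := 2) fun k s => ?_
  have hcoord : ∀ j, coord k (proj (n (j + 1)) (x j) - proj (n j) (x j)) =
      if k ∈ Set.Ico (n j) (n (j + 1)) then coord k (x j) - limit (x j) else 0 := fun j => by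
    have := hn j.le_succ
    rw [map_sub, coord_proj, coord_proj]
    grind
  have hzero : ∀ j, k ∉ Set.Ico (n j) (n (j + 1)) →
      ‖coord k (proj (n (j + 1)) (x j) - proj (n j) (x j))‖ = 0 := fun j hj => by
    rw [hcoord, if_neg hj, norm_zero]
  by_cases hk : ∃ j ∈ s, k ∈ Set.Ico (n j) (n (j + 1))
  · obtain ⟨j, hj, hkj⟩ := hk
    rw [Finset.sum_eq_single_of_mem j hj]
    · rw [hcoord, if_pos hkj, ← one_add_one_eq_two]
      exact norm_sub_le_of_le ((norm_coord_apply_le k _).trans (hx j))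
        (limit.le_of_opNorm_le_of_le norm_limit_le (hx j) |>.trans_eq (one_mul 1))
    · intro i _ hij
      exact hzero i fun hki => (hn.pairwise_disjoint_on_Ico_succ hij).le_bot ⟨hki, hkj⟩
  · rw [Finset.sum_eq_zero fun j hj => hzero j fun hkj => hk ⟨j, hj, hkj⟩]
    exact zero_le_two

section Operators

variable {Y : Type*} [NormedAddCommGroup Y] [NormedSpace ℂ Y]

theorem exists_lt_norm_apply_proj_sub_proj {S : ℕ → ConvSeq →L[ℂ] Y}
    (hS : ∀ x, Tendsto (fun k => S k x) atTop (𝓝 0)) {ε : ℝ} (hε : 0 < ε)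
    (hfreq : ∃ᶠ k in atTop, ε ≤ ‖S k‖) (N : ℕ) :
    ∃ (k m : ℕ) (x : ConvSeq),
      N ≤ k ∧ k < m ∧ ‖x‖ ≤ 1 ∧ ε / 2 < ‖S k (proj m x - proj N x)‖ := by
  have hsmall : ∀ᶠ k in atTop, ‖(S k).comp (proj N)‖ < ε / 4 :=
    (tendsto_comp_zero_of_mem_finiteRank hS (proj_mem_finiteRank N)).norm.eventually_lt_const
      (by simpa using hε)
  obtain ⟨k, hkε, hk, hNk⟩ := (hfreq.and_eventually (hsmall.and (eventually_ge_atTop N))).exists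
  obtain ⟨x, hx, hxk⟩ := (S k).exists_lt_apply_of_lt_opNorm (show 3 * ε / 4 < ‖S k‖ by linarith)
  have hlarge : ε / 2 < ‖S k (x - proj N x)‖ := by
    have hproj := ((S k).comp (proj N)).le_opNorm_of_le hx.le
    have hsub := norm_sub_norm_le (S k x) (S k (proj N x))
    rw [ContinuousLinearMap.comp_apply] at hproj
    rw [map_sub]
    linarith
  have hlim : Tendsto (fun m => ‖S k (proj m x - proj N x)‖) atTop (𝓝 ‖S k (x - proj N x)‖) :=
    (((S k).continuous.tendsto _).comp ((tendsto_proj x).sub_const _)).norm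
  obtain ⟨m, hm, hkm⟩ :=
    ((hlim.eventually_const_lt hlarge).and (eventually_gt_atTop k)).exists
  exact ⟨k, m, x, hNk, hkm, hx.le, hm⟩

/-- A gliding hump: otherwise there are almost norming vectors `b j` of `S (φ j)`, supported on
successive blocks of coordinates and hence forming a weakly unconditionally Cauchy series. -/
theorem tendsto_zero_of_tendsto_apply_isWUC {S : ℕ → ConvSeq →L[ℂ] Y}
    (hS : ∀ x, Tendsto (fun k => S k x) atTop (𝓝 0))
    (hdiag : ∀ φ : ℕ → ℕ, StrictMono φ → ∀ b : ℕ → ConvSeq, IsWUC ℂ b →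
      Tendsto (fun j => S (φ j) (b j)) atTop (𝓝 0)) :
    Tendsto S atTop (𝓝 0) := by
  by_contra hnot
  obtain ⟨ε, hε, hfreq⟩ : ∃ ε > 0, ∃ᶠ k in atTop, ε ≤ ‖S k‖ := by
    simpa [Metric.tendsto_nhds, Filter.Frequently] using hnot
  choose k m x hNk hkm hx hlt using exists_lt_norm_apply_proj_sub_proj hS hε hfreq
  let N : ℕ → ℕ := fun j => m^[j] 0
  have hN_succ : ∀ j, N (j + 1) = m (N j) := fun j => Function.iterate_succ_apply' m j 0
  have hkN : ∀ j, k (N j) < N (j + 1) := fun j => hN_succ j ▸ hkm (N j)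
  have hN : Monotone N := monotone_nat_of_le_succ fun j => (hNk (N j)).trans (hkN j).le
  have hφ : StrictMono fun j => k (N j) := strictMono_nat_of_lt_succ fun j =>
    (hkN j).trans_le (hNk (N (j + 1)))
  have hzero := hdiag _ hφ _ (isWUC_proj_sub_proj hN fun j => hx (N j))
  obtain ⟨j, hj⟩ := (hzero.norm.eventually_lt_const (by rw [norm_zero]; exact half_pos hε)).exists
  rw [hN_succ] at hj
  exact (hlt (N j)).not_gt hj

theorem avoidsCZero_clm (hY : AvoidsCZero ℂ Y) : AvoidsCZero ℂ (ConvSeq →L[ℂ] Y) := by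
  intro S hS
  refine tendsto_zero_of_tendsto_apply_isWUC (fun x => ?_) fun φ hφ b hb => ?_
  · exact hY _ (hS.map (ContinuousLinearMap.apply ℂ Y x))
  · exact hY _ ((hS.comp_injective hφ.injective).clm_apply hb)

theorem tendsto_comp_proj (hY : AvoidsCZero ℂ Y) (T : ConvSeq →L[ℂ] Y) :
    Tendsto (fun n => T.comp (proj n)) atTop (𝓝 T) := by
  have hzero : Tendsto (fun n => T - T.comp (proj n)) atTop (𝓝 0) := by
    refine tendsto_zero_of_tendsto_apply_isWUC (fun x => ?_) fun φ _ b hb => ?_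
    · simpa using ((T.continuous.tendsto x).comp (tendsto_proj x)).const_sub (T x)
    · simpa using hY _ ((isWUC_sub_proj hb φ).map T)
  simpa using hzero.const_sub T

theorem dense_finiteRank (hY : AvoidsCZero ℂ Y) :
    Dense (finiteRank ℂ ConvSeq Y : Set (ConvSeq →L[ℂ] Y)) := fun T =>
  mem_closure_of_tendsto (tendsto_comp_proj hY T)
    (Eventually.of_forall fun n => comp_mem_finiteRank T (proj_mem_finiteRank n))

theorem avoidsCZero_continuousMultilinearMap (m : ℕ) : AvoidsCZero ℂ (ConvSeq [×m]→L[ℂ] ℂ) := by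
  induction m with
  | zero =>
    exact (avoidsCZero_self ℂ).of_linearIsometry
      (continuousMultilinearCurryFin0 ℂ ConvSeq ℂ).toLinearIsometry
  | succ m ih =>
    exact (avoidsCZero_clm ih).of_linearIsometry
      (continuousMultilinearCurryLeftEquiv ℂ (fun _ : Fin (m + 1) => ConvSeq) ℂ).toLinearIsometry

end Operators

end ConvSeq

section Polynomials

variable {X : Type*} [NormedAddCommGroup X] [NormedSpace ℂ X]

theorem norm_apply_diag_le {m : ℕ} (A : X [×m]→L[ℂ] ℂ) (x : UnitBall X) :
    ‖A fun _ => x‖ ≤ ‖A‖ := by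
  have hx : ‖fun _ : Fin m => (x : X)‖ ≤ 1 :=
    (pi_norm_le_iff_of_nonneg zero_le_one).mpr fun _ => (mem_ball_zero_iff.mp x.2).le
  simpa using A.le_opNorm_mul_pow_of_le hx

variable (X) in
/-- The homogeneous polynomial `x ↦ A (x, …, x)` on the ball, depending linearly on the form `A`. -/
def homPoly (m : ℕ) : (X [×m]→L[ℂ] ℂ) →L[ℂ] (UnitBall X →ᵇ ℂ) :=
  LinearMap.mkContinuous
    { toFun := fun A => BoundedContinuousFunction.ofNormedAddCommGroup
        (fun x : UnitBall X => A fun _ => x)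
        (A.cont.comp (continuous_pi fun _ => continuous_subtype_val)) ‖A‖ (norm_apply_diag_le A)
      map_add' := fun _ _ => rfl
      map_smul' := fun _ _ => rfl } 1
    fun A => by
      rw [one_mul]
      exact BoundedContinuousFunction.norm_ofNormedAddCommGroup_le _ (norm_nonneg _)
        (norm_apply_diag_le A)

@[simp]
theorem homPoly_apply {m : ℕ} (A : X [×m]→L[ℂ] ℂ) (x : UnitBall X) :
    homPoly X m A x = A fun _ => x :=
  rfl

variable (X) in
/-- The uniform closure, on the unit ball, of the algebra of polynomials in functionals; usually
called the algebra of approximable functions and denoted `A(B)`. -/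
def approxAlgebra : Subalgebra ℂ (UnitBall X →ᵇ ℂ) :=
  (Algebra.adjoin ℂ (Set.range dualRestrict)).topologicalClosure

theorem dualRestrict_mem_approxAlgebra (φ : StrongDual ℂ X) : dualRestrict φ ∈ approxAlgebra X :=
  Subalgebra.le_topologicalClosure _ (Algebra.subset_adjoin ⟨φ, rfl⟩)

theorem homPoly_mem_approxAlgebra
    (hX : ∀ m, Dense (finiteRank ℂ X (X [×m]→L[ℂ] ℂ) : Set (X →L[ℂ] X [×m]→L[ℂ] ℂ)))
    {m : ℕ} (A : X [×m]→L[ℂ] ℂ) : homPoly X m A ∈ approxAlgebra X := by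
  induction m with
  | zero =>
    have hconst : homPoly X 0 A = algebraMap ℂ _ (A 0) := by
      ext x
      simp [Subsingleton.elim (fun _ => (x : X)) (0 : Fin 0 → X)]
    exact hconst ▸ (approxAlgebra X).algebraMap_mem _
  | succ m ih =>
    let e := continuousMultilinearCurryLeftEquiv ℂ (fun _ : Fin (m + 1) => X) ℂ
    let P : (X →L[ℂ] X [×m]→L[ℂ] ℂ) →L[ℂ] (UnitBall X →ᵇ ℂ) :=
      (homPoly X (m + 1)).comp e.symm.toContinuousLinearEquiv.toContinuousLinearMap
    have hrank_one : ∀ (φ : StrongDual ℂ X) (v : X [×m]→L[ℂ] ℂ),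
        P (φ.smulRight v) = dualRestrict φ * homPoly X m v := fun φ v => rfl
    have hfinite : finiteRank ℂ X (X [×m]→L[ℂ] ℂ) ≤
        (approxAlgebra X).toSubmodule.comap (P : _ →ₗ[ℂ] _) := by
      refine Submodule.span_le.mpr ?_
      rintro _ ⟨⟨φ, v⟩, rfl⟩
      change P (φ.smulRight v) ∈ approxAlgebra X
      rw [hrank_one]
      exact mul_mem (dualRestrict_mem_approxAlgebra φ) (ih v)
    have hclosed : IsClosed {T | P T ∈ approxAlgebra X} :=
      (Subalgebra.isClosed_topologicalClosure _).preimage P.continuous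
    have hall : ∀ T, P T ∈ approxAlgebra X := (hX m).induction hfinite hclosed
    have hcurry : P A.curryLeft = homPoly X (m + 1) A :=
      congrArg (homPoly X (m + 1)) A.uncurry_curryLeft
    exact hcurry ▸ hall A.curryLeft

end Polynomials

section Taylor

variable {X V : Type*} [NormedAddCommGroup X] [NormedSpace ℂ X] [NormedAddCommGroup V]
  [NormedSpace ℂ V]

theorem differentiableOn_comp_smul_const {F : X → V}
    (hF : AnalyticOnNhd ℂ F (Metric.ball 0 1)) {x : X} (hx : x ∈ Metric.ball (0 : X) 1) :
    DifferentiableOn ℂ (fun t : ℂ => F (t • x)) (Metric.closedBall 0 1) := fun t ht =>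
  ((hF _ (balanced_ball_zero.smul_mem (mem_closedBall_zero_iff.mp ht) hx)).differentiableAt.comp t
    (differentiableAt_id.smul_const x)).differentiableWithinAt

variable [CompleteSpace V]

theorem iteratedDeriv_comp_smul_const {F : X → V} {p : FormalMultilinearSeries ℂ X V}
    (hp : HasFPowerSeriesAt F p 0) (x : X) (n : ℕ) :
    iteratedDeriv n (fun t : ℂ => F (t • x)) 0 = n.factorial • p n fun _ => x := by
  let u : ℂ →L[ℂ] X := ContinuousLinearMap.toSpanSingleton ℂ x
  have hu : HasFPowerSeriesAt (F ∘ u) (p.compContinuousLinearMap u) 0 :=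
    HasFPowerSeriesAt.compContinuousLinearMap (by rwa [map_zero])
  obtain ⟨r, hr⟩ := hu
  have hcoeff : (p.compContinuousLinearMap u n fun _ => 1) = p n fun _ => x := by
    rw [FormalMultilinearSeries.compContinuousLinearMap_apply]
    simp [u, Function.comp_def]
  rw [iteratedDeriv_eq_iteratedFDeriv, ← hcoeff, hr.factorial_smul]
  rfl

variable {F : X → V} (hF : AnalyticOnNhd ℂ F (Metric.ball 0 1)) {x : X}
  (hx : x ∈ Metric.ball (0 : X) 1)

variable {p : FormalMultilinearSeries ℂ X V} (hp : HasFPowerSeriesAt F p 0)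

include hF hx hp

theorem hasSum_taylorSeries_smul {z : ℂ} (hz : z ∈ Metric.ball (0 : ℂ) 1) :
    HasSum (fun n => z ^ n • p n fun _ => x) (F (z • x)) := by
  have hsum := Complex.hasSum_taylorSeries_on_ball
    ((differentiableOn_comp_smul_const hF hx).mono Metric.ball_subset_closedBall) hz
  convert! hsum using 2 with n
  rw [iteratedDeriv_comp_smul_const hp, sub_zero, smul_comm, ← Nat.cast_smul_eq_nsmul ℂ,
    inv_smul_smul₀ (Nat.cast_ne_zero.mpr n.factorial_ne_zero)]

theorem norm_taylorCoeff_le {C : ℝ} (hC : ∀ y ∈ Metric.ball (0 : X) 1, ‖F y‖ ≤ C) (n : ℕ) :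
    ‖p n fun _ => x‖ ≤ C := by
  have hcauchy := Complex.norm_iteratedDeriv_le_of_forall_mem_sphere_norm_le n one_pos
    ((differentiableOn_comp_smul_const hF hx).diffContOnCl_ball subset_rfl)
    fun t ht => hC _ (balanced_ball_zero.smul_mem (mem_sphere_zero_iff_norm.mp ht).le hx)
  rw [iteratedDeriv_comp_smul_const hp, ← Nat.cast_smul_eq_nsmul ℂ, norm_smul, Complex.norm_natCast,
    one_pow, div_one] at hcauchy
  exact le_of_mul_le_mul_left hcauchy (Nat.cast_pos.mpr n.factorial_pos)

theorem norm_sum_taylorSeries_sub_le {C : ℝ} (hC : ∀ y ∈ Metric.ball (0 : X) 1, ‖F y‖ ≤ C)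
    {z : ℂ} (hz : z ∈ Metric.ball (0 : ℂ) 1) (M : ℕ) :
    ‖∑ n ∈ Finset.range M, z ^ n • p n (fun _ => x) - F (z • x)‖ ≤ C * ‖z‖ ^ M / (1 - ‖z‖) := by
  refine norm_sub_le_of_geometric_bound_of_hasSum (mem_ball_zero_iff.mp hz) (fun n => ?_)
    (hasSum_taylorSeries_smul hF hx hp hz) M
  rw [norm_smul, norm_pow, mul_comm]
  exact mul_le_mul_of_nonneg_right (norm_taylorCoeff_le hF hx hp hC n) (by positivity)

end Taylor

section Density

variable {X : Type*} [NormedAddCommGroup X] [NormedSpace ℂ X]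

theorem exists_norm_apply_smul_sub_le {V : Type*} [NormedAddCommGroup V] {F : X → V}
    (hF : UniformContinuousOn F (Metric.ball 0 1)) {ε : ℝ} (hε : 0 < ε) :
    ∃ z ∈ Metric.ball (0 : ℂ) 1, ∀ x ∈ Metric.ball (0 : X) 1, ‖F (z • x) - F x‖ ≤ ε := by
  obtain ⟨δ, hδ, hFδ⟩ := Metric.uniformContinuousOn_iff.mp hF ε hε
  have hone : (1 : ℂ) ∈ closure (Metric.ball 0 1) := by
    rw [closure_ball _ one_ne_zero]
    simp
  obtain ⟨z, hz, hzδ⟩ := Metric.mem_closure_iff.mp hone δ hδ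
  refine ⟨z, hz, fun x hx => ?_⟩
  have hdist : dist (z • x) x < δ := by
    calc dist (z • x) x = dist z 1 * ‖x‖ := by
          rw [dist_eq_norm, dist_eq_norm, ← norm_smul, sub_smul, one_smul]
      _ ≤ dist z 1 := mul_le_of_le_one_right dist_nonneg (mem_ball_zero_iff.mp hx).le
      _ < δ := by rwa [dist_comm]
  have hzx := balanced_ball_zero.smul_mem (mem_ball_zero_iff.mp hz).le hx
  exact (dist_eq_norm (F (z • x)) (F x)).symm.trans_le (hFδ _ hzx _ hx hdist).le

theorem mem_of_forall_homPoly_mem {S : Submodule ℂ (UnitBall X →ᵇ ℂ)}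
    (hS : IsClosed (S : Set (UnitBall X →ᵇ ℂ)))
    (hpoly : ∀ (m : ℕ) (A : X [×m]→L[ℂ] ℂ), homPoly X m A ∈ S) {f : UnitBall X →ᵇ ℂ}
    (hf : f ∈ Au X) : f ∈ S := by
  obtain ⟨hf_unif, F, hF, hfF⟩ := hf
  have hbound : ∀ y ∈ Metric.ball (0 : X) 1, ‖F y‖ ≤ ‖f‖ := fun y hy =>
    hfF ⟨y, hy⟩ ▸ f.norm_coe_le_norm ⟨y, hy⟩
  have hF_unif : UniformContinuousOn F (Metric.ball 0 1) := by
    rw [uniformContinuousOn_iff_restrict]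
    exact (funext hfF : ⇑f = (Metric.ball 0 1).domRestrict F) ▸ hf_unif
  obtain ⟨p, hp⟩ := hF 0 (Metric.mem_ball_self one_pos)
  refine hS.closure_subset (Metric.mem_closure_iff.mpr fun ε hε => ?_)
  obtain ⟨z, hz, hzF⟩ := exists_norm_apply_smul_sub_le hF_unif (show 0 < ε / 3 by positivity)
  have hremainder : Tendsto (fun M : ℕ => ‖f‖ * ‖z‖ ^ M / (1 - ‖z‖)) atTop (𝓝 0) := by
    simpa using ((tendsto_pow_atTop_nhds_zero_of_lt_one (norm_nonneg z)
      (mem_ball_zero_iff.mp hz)).const_mul ‖f‖).div_const (1 - ‖z‖)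
  obtain ⟨M, hM⟩ := (hremainder.eventually_lt_const (show 0 < ε / 3 by positivity)).exists
  refine ⟨∑ n ∈ Finset.range M, z ^ n • homPoly X n (p n),
    S.sum_mem fun n _ => S.smul_mem _ (hpoly n (p n)), ?_⟩
  rw [dist_comm, dist_eq_norm]
  refine ((BoundedContinuousFunction.norm_le (show 0 ≤ ε / 3 + ε / 3 by positivity)).mpr
    fun x => ?_).trans_lt (by linarith)
  have htaylor := (norm_sum_taylorSeries_sub_le hF x.2 hp hbound hz M).trans hM.le
  have heq : (∑ n ∈ Finset.range M, z ^ n • homPoly X n (p n) - f) x =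
      (∑ n ∈ Finset.range M, z ^ n • p n (fun _ => x) - F (z • x)) + (F (z • x) - F x) := by
    simp [hfF]
  exact heq ▸ norm_add_le_of_le htaylor (hzF x x.2)

theorem Au_le_approxAlgebra
    (hX : ∀ m, Dense (finiteRank ℂ X (X [×m]→L[ℂ] ℂ) : Set (X →L[ℂ] X [×m]→L[ℂ] ℂ))) :
    Au X ≤ approxAlgebra X := fun _ hf =>
  mem_of_forall_homPoly_mem (S := (approxAlgebra X).toSubmodule)
    (Subalgebra.isClosed_topologicalClosure _) (fun _ => homPoly_mem_approxAlgebra hX) hf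

end Density

section Fibers

theorem exists_tendsto_characterSpace {𝕜 A α : Type*} [NontriviallyNormedField 𝕜] [ProperSpace 𝕜]
    [NormedRing A] [NormedAlgebra 𝕜 A] (l : Ultrafilter α) {χ : α → WeakDual.characterSpace 𝕜 A}
    {C : ℝ} (hχ : ∀ a f, ‖χ a f‖ ≤ C * ‖f‖) :
    ∃ τ : WeakDual.characterSpace 𝕜 A, Tendsto χ l (𝓝 τ) := by
  have hnorm : ∀ a, ‖WeakDual.toStrongDual (χ a : WeakDual 𝕜 A)‖ ≤ |C| := fun a =>
    ContinuousLinearMap.opNorm_le_bound _ (abs_nonneg C) fun f =>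
      (hχ a f).trans (mul_le_mul_of_nonneg_right (le_abs_self C) (norm_nonneg f))
  obtain ⟨τ, -, hτ⟩ := (WeakDual.isCompact_closedBall (0 : StrongDual 𝕜 A) |C|)
    |>.ultrafilter_le_nhds' (l.map fun a => (χ a : WeakDual 𝕜 A))
      (Ultrafilter.mem_map.mpr (univ_mem' fun a => mem_closedBall_zero_iff.mpr (hnorm a)))
  have hτ_mem : τ ∈ WeakDual.characterSpace 𝕜 A :=
    WeakDual.CharacterSpace.isClosed.mem_of_tendsto hτ (Eventually.of_forall fun a => (χ a).2)
  exact ⟨⟨τ, hτ_mem⟩, tendsto_subtype_rng.mpr hτ⟩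

variable {X : Type*} [NormedAddCommGroup X] [NormedSpace ℂ X]

theorem fiber_subsingleton (hX : Au X ≤ approxAlgebra X) (z : StrongDual ℂ (StrongDual ℂ X)) :
    (fiber z).Subsingleton := by
  intro τ hτ σ hσ
  let E : Subalgebra ℂ (Au X) := AlgHom.equalizer
    (WeakDual.CharacterSpace.toAlgHom τ) (WeakDual.CharacterSpace.toAlgHom σ)
  have hE_closed : IsClosed (E : Set (Au X)) :=
    isClosed_eq (WeakDual.CharacterSpace.toCLM τ).continuous
      (WeakDual.CharacterSpace.toCLM σ).continuous
  have hadjoin : Algebra.adjoin ℂ (Set.range (dualRestrict (X := X))) ≤ E.map (Au X).val := by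
    refine Algebra.adjoin_le ?_
    rintro _ ⟨φ, rfl⟩
    exact ⟨dualToAu X φ, DFunLike.congr_fun (Eq.trans hτ (Eq.symm hσ)) φ, rfl⟩
  refine WeakDual.CharacterSpace.ext fun f => hE_closed.closure_subset ?_
  rw [closure_subtype]
  exact closure_mono hadjoin (hX f.2)

variable (X) in
/-- The canonical embedding of the ball of `X` into the bidual with the weak-star topology. -/
def ballToBidual (x : UnitBall X) : WeakDual ℂ (StrongDual ℂ X) :=
  StrongDual.toWeakDual (NormedSpace.inclusionInDoubleDual ℂ X x)

theorem norm_le_of_forall_re_lt {φ : StrongDual ℂ X} {u : ℝ}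
    (h : ∀ x : UnitBall X, (φ x).re < u) : ‖φ‖ ≤ u := by
  rw [← ContinuousLinearMap.sSup_unit_ball_eq_norm]
  refine csSup_le ((Metric.nonempty_ball.mpr one_pos).image _) ?_
  rintro _ ⟨x, hx, rfl⟩
  obtain ⟨c, hc, hcx⟩ := RCLike.exists_norm_eq_mul_self (φ x)
  have hlt := h ⟨c • x, balanced_ball_zero.smul_mem hc.le hx⟩
  rw [map_smul, smul_eq_mul, ← hcx] at hlt
  exact hlt.le

theorem exists_eq_eval_of_weakDual (g : StrongDual ℂ (WeakDual ℂ X)) : ∃ x : X, ∀ φ, g φ = φ x := by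
  obtain ⟨x, hx⟩ := LinearMap.dualEmbedding_surjective (topDualPairing ℂ X) g
  exact ⟨x, fun φ => (DFunLike.congr_fun hx φ).symm⟩

theorem convex_range_ballToBidual : Convex ℝ (Set.range (ballToBidual X)) := by
  rintro _ ⟨x, rfl⟩ _ ⟨y, rfl⟩ a b ha hb hab
  refine ⟨⟨a • x.1 + b • y.1, convex_ball (0 : X) 1 x.2 y.2 ha hb hab⟩, ?_⟩
  refine ContinuousLinearMap.ext fun φ => ?_
  change φ (a • x.1 + b • y.1) = a • φ x.1 + b • φ y.1
  rw [map_add, φ.map_smul_of_tower, φ.map_smul_of_tower]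

theorem mem_closure_range_ballToBidual {z : StrongDual ℂ (StrongDual ℂ X)} (hz : ‖z‖ ≤ 1) :
    StrongDual.toWeakDual z ∈ closure (Set.range (ballToBidual X)) := by
  by_contra hnot
  have : IsScalarTower ℝ ℂ (WeakDual ℂ (StrongDual ℂ X)) :=
    inferInstanceAs (IsScalarTower ℝ ℂ (StrongDual ℂ (StrongDual ℂ X)))
  have : LocallyConvexSpace ℝ (WeakDual ℂ (StrongDual ℂ X)) :=
    WeakBilin.locallyConvexSpace (𝕜 := ℂ) (E := StrongDual ℂ (StrongDual ℂ X))
      (F := StrongDual ℂ X)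
  obtain ⟨g, u, hg, hgz⟩ := RCLike.geometric_hahn_banach_closed_point (𝕜 := ℂ)
    convex_range_ballToBidual.closure isClosed_closure hnot
  obtain ⟨φ, hφ⟩ := exists_eq_eval_of_weakDual g
  simp only [hφ] at hg hgz
  have hφu : ‖φ‖ ≤ u := norm_le_of_forall_re_lt fun x => hg _ (subset_closure ⟨x, rfl⟩)
  have hzφ : (z φ).re ≤ ‖φ‖ :=
    (Complex.re_le_norm _).trans ((z.le_of_opNorm_le hz φ).trans_eq (one_mul _))
  exact (hgz.trans_le (hzφ.trans hφu)).false

/-- The evaluation at a point of the ball, as an element of the spectrum of `A_u(B)`. -/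
def evalCharacter (x : UnitBall X) : WeakDual.characterSpace ℂ (Au X) :=
  ⟨StrongDual.toWeakDual
      ((BoundedContinuousFunction.evalCLM ℂ x).comp (Au X).toSubmodule.subtypeL),
    fun h => one_ne_zero (DFunLike.congr_fun h (1 : Au X)), fun _ _ => rfl⟩

theorem exists_tendsto_evalCharacter (l : Ultrafilter (UnitBall X)) :
    ∃ τ : WeakDual.characterSpace ℂ (Au X), Tendsto evalCharacter l (𝓝 τ) :=
  exists_tendsto_characterSpace l fun x f => (f.1.norm_coe_le_norm x).trans_eq (one_mul _).symm

theorem continuous_toWeakDual_spectrumProj :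
    Continuous fun τ : WeakDual.characterSpace ℂ (Au X) =>
      StrongDual.toWeakDual (spectrumProj τ) :=
  WeakDual.continuous_of_continuous_eval fun φ =>
    (WeakDual.gelfandTransform ℂ (Au X) (dualToAu X φ)).continuous

theorem mem_fiber_of_tendsto {l : Filter (UnitBall X)} [l.NeBot]
    {z : StrongDual ℂ (StrongDual ℂ X)}
    (hz : Tendsto (ballToBidual X) l (𝓝 (StrongDual.toWeakDual z)))
    {τ : WeakDual.characterSpace ℂ (Au X)} (hτ : Tendsto evalCharacter l (𝓝 τ)) :
    τ ∈ fiber z :=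
  StrongDual.toWeakDual.injective <|
    tendsto_nhds_unique ((continuous_toWeakDual_spectrumProj.tendsto τ).comp hτ) hz

theorem tendsto_apply_of_tendsto_evalCharacter {l : Filter (UnitBall X)}
    {τ : WeakDual.characterSpace ℂ (Au X)} (hτ : Tendsto evalCharacter l (𝓝 τ)) (f : Au X) :
    Tendsto (fun x => (f : UnitBall X →ᵇ ℂ) x) l
      (𝓝 (WeakDual.gelfandTransform ℂ (Au X) f τ)) :=
  ((WeakDual.gelfandTransform ℂ (Au X) f).continuous.tendsto τ).comp hτ

theorem clusterSet_subset_image_fiber (f : Au X) (z : StrongDual ℂ (StrongDual ℂ X)) :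
    clusterSet f z ⊆ WeakDual.gelfandTransform ℂ (Au X) f '' fiber z := by
  rintro a ⟨l, hl, hlz, hla⟩
  have hle := Ultrafilter.of_le l
  obtain ⟨τ, hτ⟩ := exists_tendsto_evalCharacter (Ultrafilter.of l)
  exact ⟨τ, mem_fiber_of_tendsto (hlz.mono_left hle) hτ,
    tendsto_nhds_unique (tendsto_apply_of_tendsto_evalCharacter hτ f) (hla.mono_left hle)⟩

theorem exists_ultrafilter_tendsto_ballToBidual {z : StrongDual ℂ (StrongDual ℂ X)}
    (hz : ‖z‖ ≤ 1) : ∃ l : Ultrafilter (UnitBall X),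
      Tendsto (ballToBidual X) l (𝓝 (StrongDual.toWeakDual z)) := by
  have : (comap (ballToBidual X) (𝓝 (StrongDual.toWeakDual z))).NeBot :=
    comap_neBot_iff_frequently.mpr <|
      mem_closure_iff_frequently.mp (mem_closure_range_ballToBidual hz)
  exact ⟨Ultrafilter.of _, tendsto_comap.mono_left (Ultrafilter.of_le _)⟩

theorem clusterValueTheoremAt_of_fiber_subsingleton {z : StrongDual ℂ (StrongDual ℂ X)}
    (hz : ‖z‖ ≤ 1) (hsub : (fiber z).Subsingleton) :
    ClusterValueTheoremAt z ∧ ∃ τ, fiber z = {τ} := by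
  obtain ⟨l, hl⟩ := exists_ultrafilter_tendsto_ballToBidual hz
  obtain ⟨τ, hτ⟩ := exists_tendsto_evalCharacter l
  have hfiber : fiber z = {τ} := hsub.eq_singleton_of_mem (mem_fiber_of_tendsto hl hτ)
  refine ⟨fun f => (clusterSet_subset_image_fiber f z).antisymm ?_, τ, hfiber⟩
  rw [hfiber, Set.image_singleton, Set.singleton_subset_iff]
  exact ⟨l, l.neBot, hl, tendsto_apply_of_tendsto_evalCharacter hτ f⟩

end Fibers

end ClusterValue

end

theorem corollary2
    (z : StrongDual ℂ (StrongDual ℂ ClusterValue.ConvSeq)) (hz : z ∈ Metric.closedBall 0 1) :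
    ClusterValue.ClusterValueTheoremAt z ∧ ∃ τ, ClusterValue.fiber z = {τ} := by
  have happrox : ClusterValue.Au ClusterValue.ConvSeq ≤
      ClusterValue.approxAlgebra ClusterValue.ConvSeq :=
    ClusterValue.Au_le_approxAlgebra fun m => ClusterValue.ConvSeq.dense_finiteRank
      (ClusterValue.ConvSeq.avoidsCZero_continuousMultilinearMap m)
  have hsub : (ClusterValue.fiber z).Subsingleton := ClusterValue.fiber_subsingleton happrox z
  exact ClusterValue.clusterValueTheoremAt_of_fiber_subsingleton
    ((dist_zero_right z).symm.trans_le (Metric.mem_closedBall.mp hz)) hsub
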